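/- **Setting.** Let $\mathcal V,\mathcal H$ be real Hilbert spaces with $\mathcal V$ densely and continuously embedded into $\mathcal H$; identify $\mathcal H$ with its dual, so that $\mathcal V\hookrightarrow\mathcal H\hookrightarrow\mathcal V'$, and let $\langle\cdot,\cdot\rangle$ be the duality pairing between $\mathcal V'$ and $\mathcal V$. Let $J\ge 1$ and, for $j=1,\dots,J$, let $X_j$ be a metric space with a finite measure $\mu_j$ on a $\sigma$-algebra containing the open sets, $N_j\ge1$, and $U_j$ a closed subspace of $L^2(X_j,\mu_j)^{N_j}$. Let $U=\prod_jU_j$ and let $I_U:\mathcal V\to U$ be a continuous linear map. Let $A_1:\mathcal V\to\mathcal V'$ be bounded and linear with $\langle A_1u,u\rangle=0$ for all $u\in\mathcal V$. Let $\alpha_j\in C([0,\infty)\times X_j;(0,\infty))$ be locally Lipschitz in time (for every $\tau>0$ there is $\kappa(\tau)>0$ with $|\alpha_j(t,x)-\alpha_j(s,x)|\le\kappa(\tau)|t-s|$ for all $s,t\in[0,\tau]$, $x\in X_j$), and let $g_j:\mathbb R^{N_j}\to\mathbb R^{N_j}$ be continuous with $(g_j(x)-g_j(y))\cdot(x-y)\ge0$,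 $g_j(0)=0$ and $|g_j(x)|\le M(1+|x|)$, for a constant $M>0$. Define $B(t):\mathcal V\to\mathcal V'$ by $$\langle B(t)u,v\rangle=\sum_{j=1}^J\int_{X_j}\alpha_j(t,x_j)\,g_j((I_Uu)_j(x_j))\cdot(I_Uv)_j(x_j)\,d\mu_j(x_j),$$ and let $\mathcal A_B(t)v=(A_1+B(t))v$ on $D(\mathcal A_B(t))=\{v\in\mathcal V:(A_1+B(t))v\in\mathcal H\}$. A solution is a function $x\in C([0,\infty),\mathcal H)$ with $x(t)\in D(\mathcal A_B(t))$ for all $t\ge0$ such that, outside a countable set of times, $x'(t)=-\mathcal A_B(t)x(t)$ exists in $\mathcal H$ and is continuous. Its energy is $\mathcal E(t)=\frac12\|x(t)\|_{\mathcal H}^2$. **Assumptions.** (a) Writing $I_U$ also for the operator $\mathcal V\to\mathcal V'$ given by $\langle I_Uu,v\rangle=(I_Uu,I_Uv)_U$, the operator $A_1-I_U$ generates a strongly continuous semigroup of contractions in $\mathcal H$, and $-A_1-I_U$ generates a strongly continuous semigroup of contractions $S(t)$ with $\|S(t)x_0\|_{\mathcal H}\le Ce^{-\omega t}\|x_0\|_{\mathcal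 H}$ for all $t\ge 0$, $x_0\in\mathcal H$, where $C,\omega>0$. (Both operators have as domain the set of $v\in\mathcal V$ that they map into $\mathcal H$.) (b) There are $m>0$ and a continuous, concave, strictly increasing $G:[0,\infty)\to[0,\infty)$ with $G(0)=0$ such that, for all $j$, $g_j(x)\cdot x\ge m|x|^2$ if $|x|\ge1$, and $|x|^2+|g_j(x)|^2\le G(g_j(x)\cdot x)$ if $|x|\le1$. (c) There are constants $\alpha_0,\tilde\alpha>0$ with $\alpha_0\le\alpha_j(t,x_j)\le\tilde\alpha$ for all $t\ge0$, $x_j\in X_j$, $j=1,\dots,J$. **Theorem (oscillating case).** For given $J$, $C$ and $\omega$ there is $T_0>0$ such that for every $T\ge T_0$ there is $c>0$, depending only on $J$, $T$, $C$, $\omega$, $\max_j\mu_j(X_j)$, $\tilde\alpha$, $\alpha_0$, $M$ and $m$, with the following property. Under the above assumptions, $h(x)=c\,(x+G(x))$ is a bijection of $[0,\infty)$; let $p=h^{-1}$ and $\mu=\min_j\mu_j(X_j)$. Let $x$ be any solution. If $\mathcal E(0)>0$, then $\psi(x)=\int_x^{\mathcal E(0)}\frac{ds}{p(s)}$ is well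 defined and strictly decreasing on $(0,\infty)$, its range contains $[0,\infty)$, and $$\mathcal E(t)\le\psi^{-1}\big(T\mu\alpha_0(t-T)\big)\qquad\text{for all }t\ge T.$$ If $\mathcal E(0)=0$, then $\mathcal E(t)=0$ for all $t\ge T$. In particular the bound is the same, with the same $c$, as for any autonomous coefficients $\alpha_j(t,x_j)=\alpha_j(x_j)$ satisfying (c). -/

import Mathlib

open Set Filter Topology MeasureTheory
open scoped InnerProductSpace

noncomputable section

namespace HyperbolicDamping

/-- Data and standing assumptions of the abstract hyperbolic setting with the damping
`⟨B(t)u, v⟩ = ∑ j, ∫ α j t x * (g j ((I_U u) j x) · (I_U v) j x) dμ j(x)`. -/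
structure DampedSystem {J : ℕ} (N : Fin J → ℕ)
    (V H : Type*) [NormedAddCommGroup V] [InnerProductSpace ℝ V] [CompleteSpace V]
    [NormedAddCommGroup H] [InnerProductSpace ℝ H] [CompleteSpace H]
    (X : Fin J → Type*) [∀ j, MetricSpace (X j)] [∀ j, MeasurableSpace (X j)]
    [∀ j, OpensMeasurableSpace (X j)] where
  /-- The dense continuous embedding of `V` into `H`. -/
  ι : V →L[ℝ] H
  ι_injective : Function.Injective ι
  ι_dense : DenseRange ι
  /-- The finite measures on the spaces `X j`. -/
  μ : ∀ j, Measure (X j)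
  μ_finite : ∀ j, IsFiniteMeasure (μ j)
  N_pos : ∀ j, 0 < N j
  /-- The closed subspaces `U j` of `L²(X j, μ j)^(N j)`; the control space is their product. -/
  U : ∀ j, Submodule ℝ (Lp (EuclideanSpace ℝ (Fin (N j))) 2 (μ j))
  U_closed : ∀ j, IsClosed (U j : Set (Lp (EuclideanSpace ℝ (Fin (N j))) 2 (μ j)))
  /-- The continuous linear map `I_U` from `V` to the Hilbert product `U = ∏ j, U j`. -/
  IU : V →L[ℝ] PiLp 2 (fun j => U j)
  /-- The bounded linear operator `A₁` from `V` to its dual. -/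
  A₁ : V →L[ℝ] StrongDual ℝ V
  A₁_skew : ∀ u, A₁ u u = 0
  /-- The time dependent coefficients. -/
  α : ∀ j, ℝ → X j → ℝ
  α_continuous : ∀ j, ContinuousOn (fun q : ℝ × X j => α j q.1 q.2) (Ici 0 ×ˢ univ)
  α_pos : ∀ j t x, 0 ≤ t → 0 < α j t x
  α_lipschitz : ∀ j, ∀ τ > 0, ∃ κ > 0, ∀ s ∈ Icc 0 τ, ∀ t ∈ Icc 0 τ, ∀ x,
    |α j t x - α j s x| ≤ κ * |t - s|
  /-- The nonlinear feedbacks. -/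
  g : ∀ j, EuclideanSpace ℝ (Fin (N j)) → EuclideanSpace ℝ (Fin (N j))
  g_continuous : ∀ j, Continuous (g j)
  g_monotone : ∀ j x y, 0 ≤ ⟪g j x - g j y, x - y⟫_ℝ
  g_zero : ∀ j, g j 0 = 0

/-- `S` (restricted to `t ≥ 0`) is a strongly continuous semigroup of contractions. -/
structure IsContractionSemigroup {H : Type*} [NormedAddCommGroup H] [InnerProductSpace ℝ H]
    (S : ℝ → H →L[ℝ] H) : Prop where
  zero : S 0 = ContinuousLinearMap.id ℝ H
  add : ∀ s t, 0 ≤ s → 0 ≤ t → S (s + t) = (S s).comp (S t)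
  continuous : ∀ u, ContinuousOn (fun t => S t u) (Ici 0)
  contraction : ∀ t, 0 ≤ t → ‖S t‖ ≤ 1

/-- The (possibly unbounded) operator with graph `{(u, f) | R u f}` is the infinitesimal generator
of `S`: `u` lies in its domain with value `f` exactly when `(S t u - u) / t → f` as `t → 0+`. -/
def IsGenerator {H : Type*} [NormedAddCommGroup H] [InnerProductSpace ℝ H]
    (R : H → H → Prop) (S : ℝ → H →L[ℝ] H) : Prop :=
  ∀ u f, R u f ↔ Tendsto (fun t : ℝ => t⁻¹ • (S t u - u)) (𝓝[>] 0) (𝓝 f)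

namespace DampedSystem

variable {J : ℕ} {N : Fin J → ℕ}
  {V H : Type*} [NormedAddCommGroup V] [InnerProductSpace ℝ V] [CompleteSpace V]
  [NormedAddCommGroup H] [InnerProductSpace ℝ H] [CompleteSpace H]
  {X : Fin J → Type*} [∀ j, MetricSpace (X j)] [∀ j, MeasurableSpace (X j)]
  [∀ j, OpensMeasurableSpace (X j)]

/-- The component `(I_U u) j`, as a function on `X j`. -/
def comp (P : DampedSystem N V H X) (u : V) (j : Fin J) : X j → EuclideanSpace ℝ (Fin (N j)) :=
  fun x => ((P.IU u j : P.U j) : Lp (EuclideanSpace ℝ (Fin (N j))) 2 (P.μ j)) x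

/-- The pairing `⟨B(t)u, v⟩`. -/
def damping (P : DampedSystem N V H X) (t : ℝ) (u v : V) : ℝ :=
  ∑ j, ∫ x, P.α j t x * ⟪P.g j (P.comp u j x), P.comp v j x⟫_ℝ ∂(P.μ j)

/-- `u ∈ D(𝒜_B(t))` and `𝒜_B(t) u = f`: that is, `u ∈ V` and `(A₁ + B(t)) u`, an element of the
dual of `V`, is the element `f` of `H`. -/
def opGraph (P : DampedSystem N V H X) (t : ℝ) (u f : H) : Prop :=
  ∃ v : V, P.ι v = u ∧ ∀ w : V, P.A₁ v w + P.damping t v w = ⟪f, P.ι w⟫_ℝ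

/-- The graph in `H` of the linear operator `A₁ - I_U`, where `I_U` is read as the operator
`⟨I_U v, w⟩ = (I_U v, I_U w)_U` from `V` to its dual. -/
def graphBackward (P : DampedSystem N V H X) (u f : H) : Prop :=
  ∃ v : V, P.ι v = u ∧ ∀ w : V, P.A₁ v w - ⟪P.IU v, P.IU w⟫_ℝ = ⟪f, P.ι w⟫_ℝ

/-- The graph in `H` of the linear operator `-A₁ - I_U`. -/
def graphForward (P : DampedSystem N V H X) (u f : H) : Prop :=
  ∃ v : V, P.ι v = u ∧ ∀ w : V, -P.A₁ v w - ⟪P.IU v, P.IU w⟫_ℝ = ⟪f, P.ι w⟫_ℝ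

/-- `A₁ - I_U` generates a semigroup of contractions, and `-A₁ - I_U` generates a semigroup of
contractions that is exponentially stable with constants `C` and `ω`. -/
def LinearlyStable (P : DampedSystem N V H X) (C ω : ℝ) : Prop :=
  (∃ S : ℝ → H →L[ℝ] H, IsContractionSemigroup S ∧ IsGenerator P.graphBackward S) ∧
  ∃ S : ℝ → H →L[ℝ] H, IsContractionSemigroup S ∧ IsGenerator P.graphForward S ∧
    ∀ t, 0 ≤ t → ∀ u, ‖S t u‖ ≤ C * Real.exp (-ω * t) * ‖u‖

/-- `x` is a solution on `[0, ∞)` of `x' + A₁ x + B(t) x = 0` with initial value `x 0`: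
`x ∈ C([0, ∞); H)`, `x t ∈ D(𝒜_B(t))` for all `t ≥ 0`, and outside a countable set the derivative
`x' = -𝒜_B(t) x` exists in `H` and is continuous. -/
def IsSolution (P : DampedSystem N V H X) (x : ℝ → H) : Prop :=
  ContinuousOn x (Ici 0) ∧
  ∃ f : ℝ → H, (∀ t, 0 ≤ t → P.opGraph t (x t) (f t)) ∧
    ∃ Z : Set ℝ, Z.Countable ∧ ∀ t ∈ Ici (0 : ℝ) \ Z,
      HasDerivWithinAt x (-f t) (Ici 0) t ∧ ContinuousWithinAt f (Ici 0 \ Z) t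

end DampedSystem

/-- The energy `𝓔(t) = ‖x(t)‖² / 2`. -/
def energy {H : Type*} [NormedAddCommGroup H] (x : ℝ → H) (t : ℝ) : ℝ := ‖x t‖ ^ 2 / 2

/-- `h(x) = c (x + G(x))`. -/
def hFun (c : ℝ) (G : ℝ → ℝ) (x : ℝ) : ℝ := c * (x + G x)

/-- `p = h⁻¹` on `[0, ∞)`. -/
def pFun (c : ℝ) (G : ℝ → ℝ) : ℝ → ℝ := Function.invFunOn (hFun c G) (Ici 0)

/-- `ψ(x) = ∫ s in x..E₀, 1 / p(s)` for `x > 0`. -/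
def psi (c : ℝ) (G : ℝ → ℝ) (E₀ x : ℝ) : ℝ := ∫ s in x..E₀, 1 / pFun c G s

/-- The inverse `ψ⁻¹` of `ψ` as a function on `(0, ∞)`. -/
def psiInv (c : ℝ) (G : ℝ → ℝ) (E₀ : ℝ) : ℝ → ℝ := Function.invFunOn (psi c G E₀) (Ioi 0)

end HyperbolicDamping

end

/-! The proof compares the damped solution `x` with the linear semigroup `S` over one period. Let
`d(t) = x(t) - S(t - a) x(a)` on `[a, a + T]`, and formally let `v`, `w` in `V` represent `x(t)` and
`d(t)`. Skewness of `A₁` removes it from the derivative of `‖d‖² / 2`, leaving `-⟨B v, w⟩ + (I_U v,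
I_U w) - ‖I_U w‖²`. By Young's inequality the last term absorbs all the `w`, and a multiple of `∑ j,
∫ |I_U v|² + |g(I_U v)|²` remains.

Concavity of `G` enters through a supporting line `G(r) ≤ β + σ r`, in place of Jensen's inequality:
the remainder becomes a constant plus a multiple of `⟨B v, v⟩`, which is exactly the rate of energy
loss (`source_le`, `energy_add_le`). Since `‖S T‖ ≤ 1/2` for large `T`, the energy at `a` is bounded
by `h` of the rescaled loss over `[a, a + T]` (`energy_le_hFun`), that is, `T² μ α₀ p(𝓔(a)) ≤ 𝓔(a) -
𝓔(a + T)`. As `1/p` is decreasing, `ψ(𝓔)` grows by at least `T² μ α₀` per period, and iteration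
gives the decay (`le_psiInv_of_periodic_loss`). The constants see `α` only through its two bounds,
hence the same `c` as in the autonomous case. -/

namespace HyperbolicDamping

/-! ### Real analysis: monotonicity and supporting lines. -/

/-- A continuous function whose right derivative is nonpositive outside a countable set does not
increase. -/
theorem le_of_hasDerivWithinAt_nonpos_off_countable {ρ ρ' : ℝ → ℝ} {a b : ℝ} (hab : a ≤ b)
    (hc : ContinuousOn ρ (Icc a b)) {Z : Set ℝ} (hZ : Z.Countable)
    (hd : ∀ t ∈ Ico a b \ Z, HasDerivWithinAt ρ (ρ' t) (Ioi t) t)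
    (hn : ∀ t ∈ Ico a b \ Z, ρ' t ≤ 0) : ρ b ≤ ρ a := by
  by_contra! hlt
  have hab' : a < b := lt_of_le_of_ne hab (by rintro rfl; exact lt_irrefl _ hlt)
  obtain ⟨ε, hε, hεb⟩ : ∃ ε > 0, ε * (b - a) < ρ b - ρ a := by
    refine ⟨(ρ b - ρ a) / (2 * (b - a)), by have := sub_pos.2 hab'; have := sub_pos.2 hlt; positivity, ?_⟩
    have : b - a ≠ 0 := (sub_pos.2 hab').ne'
    have : (ρ b - ρ a) / (2 * (b - a)) * (b - a) = (ρ b - ρ a) / 2 := by field_simp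
    linarith
  -- The tilt makes the right derivatives strictly negative off `Z` but keeps `q a < q b`.
  set q : ℝ → ℝ := fun t => ρ t - ε * (t - a) with hq
  have hqc : ContinuousOn q (Icc a b) := hc.sub (by fun_prop)
  have hqab : q a < q b := by simp only [hq]; linarith
  -- `q '' Z` is countable, so some intermediate level avoids it; the last time `s` with `q ≤ y` is
  -- then not exceptional, yet the slopes to its right are positive.
  obtain ⟨y, hyZ, hay, hyb⟩ := ((hZ.image q).dense_compl ℝ).exists_between hqab
  have hAc : IsCompact (Icc a b ∩ q ⁻¹' Iic y) :=
    isCompact_Icc.of_isClosed_subset (hqc.preimage_isClosed_of_isClosed isClosed_Icc isClosed_Iic)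
      inter_subset_left
  obtain ⟨⟨⟨has, hsb⟩, hsy⟩, hmax⟩ := hAc.isGreatest_sSup ⟨a, ⟨le_rfl, hab⟩, hay.le⟩
  set s := sSup (Icc a b ∩ q ⁻¹' Iic y)
  have hsb' : s < b := lt_of_le_of_ne hsb (by rintro h; rw [h] at hsy; exact absurd hyb (not_lt.2 hsy))
  have hup : ∀ᶠ t in 𝓝[>] s, t ∈ Icc a b ∧ y < q t := by
    filter_upwards [Ioc_mem_nhdsGT hsb'] with t ht
    refine ⟨⟨has.trans ht.1.le, ht.2⟩, ?_⟩
    by_contra! h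
    exact absurd (hmax ⟨⟨has.trans ht.1.le, ht.2⟩, h⟩) (not_le.2 ht.1)
  have hqs : q s = y := by
    refine le_antisymm hsy ?_
    have : Tendsto q (𝓝[>] s) (𝓝 (q s)) :=
      (hqc s ⟨has, hsb⟩).mono_left (nhdsWithin_le_iff.2 (hup.mono fun t ht => ht.1))
    exact ge_of_tendsto this (hup.mono fun t ht => ht.2.le)
  have hsZ : s ∉ Z := fun h => hyZ ⟨s, h, hqs⟩
  have hs : s ∈ Ico a b \ Z := ⟨⟨has, hsb'⟩, hsZ⟩
  have hder : HasDerivWithinAt q (ρ' s - ε * 1) (Ioi s) s :=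
    (hd s hs).sub (((hasDerivWithinAt_id s _).sub_const a).const_mul ε)
  have hneg : ρ' s - ε * 1 < 0 := by linarith [hn s hs]
  have hsl := (hasDerivWithinAt_iff_tendsto_slope' (by simp)).1 hder
  obtain ⟨t, ht1, ⟨-, ht2⟩, ht3⟩ := ((hsl.eventually (gt_mem_nhds hneg)).and
    (hup.and self_mem_nhdsWithin)).exists
  have ht3 : s < t := ht3
  rw [slope_def_field] at ht1
  have : 0 < (q t - q s) / (t - s) := div_pos (by linarith) (sub_pos.2 ht3)
  linarith

/-- A concave increasing function on `[0, ∞)` has a nonnegative supergradient at positive points. -/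
theorem exists_supergradient {G : ℝ → ℝ} (hG : ConcaveOn ℝ (Ici 0) G)
    (hmono : MonotoneOn G (Ici 0)) {s₀ : ℝ} (hs : 0 < s₀) :
    ∃ σ ≥ 0, ∀ s ≥ 0, G s ≤ G s₀ + σ * (s - s₀) := by
  -- The supremum of the slopes to the right of `s₀` serves as `σ`; the slopes to the left bound it
  -- from above by concavity.
  set S : Set ℝ := (fun y => (G y - G s₀) / (y - s₀)) '' Ioi s₀
  have hle : ∀ x, 0 ≤ x → x < s₀ → ∀ r ∈ S, r ≤ (G s₀ - G x) / (s₀ - x) := by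
    rintro x hx hxs _ ⟨y, hy, rfl⟩
    exact hG.slope_anti_adjacent hx (hs.le.trans hy.le) hxs hy
  have hbdd : BddAbove S := ⟨_, hle 0 le_rfl hs⟩
  have hne : S.Nonempty := ⟨_, s₀ + 1, by simp, rfl⟩
  have hub : ∀ y, s₀ < y → (G y - G s₀) / (y - s₀) ≤ sSup S := fun y hy => le_csSup hbdd ⟨y, hy, rfl⟩
  refine ⟨sSup S, ?_, fun s hs0 => ?_⟩
  · refine le_trans ?_ (hub (s₀ + 1) (by linarith))
    have h1 : (s₀ + 1) ∈ Ici (0 : ℝ) := by simp only [mem_Ici]; linarith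
    have := hmono hs.le h1 (by linarith)
    exact div_nonneg (by linarith) (by linarith)
  · rcases lt_trichotomy s s₀ with h | rfl | h
    · have := csSup_le hne (hle s hs0 h)
      rw [le_div_iff₀ (by linarith)] at this
      linarith
    · simp
    · have := hub s h
      rw [div_le_iff₀ (by linarith)] at this
      linarith

/-! ### Contraction semigroups and their generators. -/

section Semigroup

variable {H : Type*} [NormedAddCommGroup H] [InnerProductSpace ℝ H] {S : ℝ → H →L[ℝ] H}

/-- The domain of the generator of a semigroup is dense. -/
theorem IsContractionSemigroup.exists_generator_near [CompleteSpace H]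
    (hS : IsContractionSemigroup S) (u : H)
    {ε : ℝ} (hε : 0 < ε) :
    ∃ v f, ‖v - u‖ < ε ∧ Tendsto (fun t : ℝ => t⁻¹ • (S t v - v)) (𝓝[>] 0) (𝓝 f) := by
  -- Truncating time at `0` makes the orbit continuous on all of `ℝ`. The approximant is the average
  -- of the orbit over a short interval `[0, h]`.
  set F : ℝ → H := fun s => S (max s 0) u with hF
  have hFc : Continuous F :=
    (hS.continuous u).comp_continuous (by fun_prop) (fun s => le_max_right s 0)
  set Ψ : ℝ → H := fun t => ∫ s in (0 : ℝ)..t, F s with hΨ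
  have hΨd : ∀ t, HasDerivAt Ψ (F t) t := fun t => hFc.integral_hasStrictDerivAt 0 t |>.hasDerivAt
  have hΨ0 : Ψ 0 = 0 := by simp [hΨ]
  have hF0 : F 0 = u := by simp [hF, hS.zero]
  have hshift : ∀ t h, 0 ≤ t → 0 ≤ h → S t (Ψ h) = Ψ (t + h) - Ψ t := by
    intro t h ht hh
    have h1 : S t (Ψ h) = ∫ s in (0 : ℝ)..h, S t (F s) :=
      ((S t).intervalIntegral_comp_comm (hFc.intervalIntegrable 0 h)).symm
    have h2 : ∫ s in (0 : ℝ)..h, S t (F s) = ∫ s in (0 : ℝ)..h, F (t + s) := by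
      refine intervalIntegral.integral_congr fun s hs => ?_
      rw [uIcc_of_le hh] at hs
      simp only [hF, max_eq_left hs.1, max_eq_left (add_nonneg ht hs.1), hS.add t s ht hs.1,
        ContinuousLinearMap.comp_apply]
    rw [h1, h2, intervalIntegral.integral_comp_add_left, add_zero, hΨ,
      intervalIntegral.integral_interval_sub_left (hFc.intervalIntegrable _ _)
        (hFc.intervalIntegrable _ _)]
  have hslope : ∀ x, Tendsto (fun t : ℝ => t⁻¹ • (Ψ (x + t) - Ψ x)) (𝓝[>] 0) (𝓝 (F x)) :=
    fun x => (hasDerivAt_iff_tendsto_slope_zero.1 (hΨd x)).mono_left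
      (nhdsWithin_mono _ fun t (ht : 0 < t) => ht.ne')
  have h0 := hslope 0
  simp only [zero_add, hΨ0, sub_zero, hF0] at h0
  obtain ⟨h, hh, hpos⟩ := ((h0.eventually (Metric.ball_mem_nhds u hε)).and
    self_mem_nhdsWithin).exists
  rw [dist_eq_norm] at hh
  have hpos : 0 < h := hpos
  refine ⟨h⁻¹ • Ψ h, h⁻¹ • (F h - F 0), hh, ?_⟩
  refine (((hslope h).sub (hslope 0)).const_smul h⁻¹).congr' ?_
  filter_upwards [self_mem_nhdsWithin] with t ht
  rw [map_smul, hshift t h (le_of_lt ht) hpos.le, ← smul_sub, ← smul_sub, smul_comm, zero_add, hΨ0,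
    add_comm h t]
  congr 2
  abel

/-- Orbits of points of the domain stay in the domain. -/
theorem IsContractionSemigroup.tendsto_generator_orbit (hS : IsContractionSemigroup S) {v f : H}
    (hv : Tendsto (fun t : ℝ => t⁻¹ • (S t v - v)) (𝓝[>] 0) (𝓝 f)) {s : ℝ} (hs : 0 ≤ s) :
    Tendsto (fun t : ℝ => t⁻¹ • (S t (S s v) - S s v)) (𝓝[>] 0) (𝓝 (S s f)) := by
  refine (((S s).continuous.tendsto f).comp hv).congr' ?_
  filter_upwards [self_mem_nhdsWithin] with t ht
  have ht : 0 ≤ t := le_of_lt ht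
  have h1 : S t (S s v) = S s (S t v) := by
    rw [← ContinuousLinearMap.comp_apply, ← hS.add t s ht hs, add_comm, hS.add s t hs ht,
      ContinuousLinearMap.comp_apply]
  simp only [Function.comp_apply, map_smul, map_sub, h1]

/-- The right derivative of an orbit started at time `a`. -/
theorem IsContractionSemigroup.hasDerivWithinAt_orbit (hS : IsContractionSemigroup S) {v f : H}
    {a s : ℝ} (hs : a ≤ s)
    (hv : Tendsto (fun t : ℝ => t⁻¹ • (S t (S (s - a) v) - S (s - a) v)) (𝓝[>] 0) (𝓝 f)) :
    HasDerivWithinAt (fun t => S (t - a) v) f (Ioi s) s := by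
  rw [hasDerivWithinAt_iff_tendsto_slope' (by simp)]
  have hsub : Tendsto (fun t : ℝ => t - s) (𝓝[>] s) (𝓝[>] 0) := by
    refine tendsto_nhdsWithin_iff.2 ⟨?_, ?_⟩
    · have : Tendsto (fun t : ℝ => t - s) (𝓝 s) (𝓝 (s - s)) := by
        exact (continuous_id.sub continuous_const).tendsto s
      rw [sub_self] at this
      exact this.mono_left nhdsWithin_le_nhds
    · filter_upwards [self_mem_nhdsWithin] with t ht
      exact sub_pos.2 (mem_Ioi.1 ht)
  refine (hv.comp hsub).congr' ?_
  filter_upwards [self_mem_nhdsWithin] with t ht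
  have ht : s < t := ht
  have : S (t - a) v = S (t - s) (S (s - a) v) := by
    rw [← ContinuousLinearMap.comp_apply, ← hS.add _ _ (sub_pos.2 ht).le (sub_nonneg.2 hs),
      sub_add_sub_cancel]
  simp only [Function.comp_apply, slope, vsub_eq_sub, this]

end Semigroup

/-! ### The scalar functions `h`, `p`, `ψ` and the iteration over periods. -/

section Scalar

variable {c : ℝ} {G : ℝ → ℝ}

theorem bijOn_hFun (hc : 0 < c) (hmono : StrictMonoOn G (Ici 0)) (hG0 : G 0 = 0)
    (hcont : ContinuousOn G (Ici 0)) : BijOn (hFun c G) (Ici 0) (Ici 0) := by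
  have hnn : ∀ x ∈ Ici (0 : ℝ), 0 ≤ G x := fun x hx => hG0 ▸ hmono.monotoneOn self_mem_Ici hx hx
  refine ⟨fun x hx => mul_nonneg hc.le (add_nonneg hx (hnn x hx)), ?_, fun y hy => ?_⟩
  · refine StrictMonoOn.injOn fun x hx y hy hxy => ?_
    have := hmono hx hy hxy
    exact mul_lt_mul_of_pos_left (by linarith) hc
  · have hy : 0 ≤ y := hy
    have hyc : 0 ≤ y / c := by positivity
    have hco : ContinuousOn (hFun c G) (Icc 0 (y / c)) :=
      (continuousOn_const.mul (continuousOn_id.add hcont)).mono Icc_subset_Ici_self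
    have h1 : y ≤ hFun c G (y / c) := by
      have : c * (y / c) = y := by field_simp
      have := mul_nonneg hc.le (hnn _ hyc)
      simp only [hFun]; linarith
    have h0 : hFun c G 0 = 0 := by simp [hFun, hG0]
    obtain ⟨x, hx, hxy⟩ := intermediate_value_Icc hyc hco ⟨h0.le.trans hy, h1⟩
    exact ⟨x, hx.1, hxy⟩

theorem hFun_le_hFun (hc : 0 < c) (hmono : StrictMonoOn G (Ici 0)) {x y : ℝ} (hx : 0 ≤ x)
    (hxy : x ≤ y) : hFun c G x ≤ hFun c G y := by
  have := hmono.monotoneOn hx (hx.trans hxy) hxy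
  exact mul_le_mul_of_nonneg_left (by linarith) hc.le

variable (hc : 0 < c) (hmono : StrictMonoOn G (Ici 0)) (hG0 : G 0 = 0)
  (hcont : ContinuousOn G (Ici 0))

include hc hmono hG0 hcont

theorem pFun_nonneg {y : ℝ} (hy : 0 ≤ y) : 0 ≤ pFun c G y :=
  Function.invFunOn_mem ((bijOn_hFun hc hmono hG0 hcont).surjOn hy)

theorem hFun_pFun {y : ℝ} (hy : 0 ≤ y) : hFun c G (pFun c G y) = y :=
  Function.invFunOn_eq ((bijOn_hFun hc hmono hG0 hcont).surjOn hy)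

theorem pFun_le_of_le_hFun {x y : ℝ} (hy : 0 ≤ y) (hx : 0 ≤ x) (h : y ≤ hFun c G x) :
    pFun c G y ≤ x := by
  by_contra! hlt
  have h1 := hFun_le_hFun hc hmono hx hlt.le
  rw [hFun_pFun hc hmono hG0 hcont hy] at h1
  have h2 := (bijOn_hFun hc hmono hG0 hcont).injOn hx (pFun_nonneg hc hmono hG0 hcont hy)
    ((h.antisymm h1).symm.trans (hFun_pFun hc hmono hG0 hcont hy).symm)
  exact hlt.ne h2

theorem pFun_mono {x y : ℝ} (hx : 0 ≤ x) (hxy : x ≤ y) : pFun c G x ≤ pFun c G y :=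
  pFun_le_of_le_hFun hc hmono hG0 hcont hx (pFun_nonneg hc hmono hG0 hcont (hx.trans hxy))
    (by rwa [hFun_pFun hc hmono hG0 hcont (hx.trans hxy)])

theorem pFun_pos {y : ℝ} (hy : 0 < y) : 0 < pFun c G y := by
  refine lt_of_le_of_ne (pFun_nonneg hc hmono hG0 hcont hy.le) fun h => ?_
  have := hFun_pFun hc hmono hG0 hcont hy.le
  simp [← h, hFun, hG0] at this
  exact hy.ne this

theorem pFun_le_div {y : ℝ} (hy : 0 ≤ y) : pFun c G y ≤ y / c := by
  have h1 := pFun_nonneg hc hmono hG0 hcont hy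
  have h2 : 0 ≤ G (pFun c G y) := hG0 ▸ hmono.monotoneOn self_mem_Ici h1 h1
  rw [le_div_iff₀ hc]
  conv_rhs => rw [← hFun_pFun hc hmono hG0 hcont hy, hFun]
  nlinarith

theorem intervalIntegrable_inv_pFun {x y : ℝ} (hx : 0 < x) (hy : 0 < y) :
    IntervalIntegrable (fun s => 1 / pFun c G s) volume x y := by
  refine AntitoneOn.intervalIntegrable fun s hs t ht hst => ?_
  have hs0 : 0 < s := (lt_min hx hy).trans_le hs.1
  exact one_div_le_one_div_of_le (pFun_pos hc hmono hG0 hcont hs0)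
    (pFun_mono hc hmono hG0 hcont hs0.le hst)

theorem psi_sub_psi {E₀ x y : ℝ} (hE : 0 < E₀) (hx : 0 < x) (hy : 0 < y) :
    psi c G E₀ x - psi c G E₀ y = ∫ s in x..y, 1 / pFun c G s := by
  have h := intervalIntegral.integral_add_adjacent_intervals
    (intervalIntegrable_inv_pFun hc hmono hG0 hcont hx hy)
    (intervalIntegrable_inv_pFun hc hmono hG0 hcont hy hE)
  simp only [psi]; linarith

/-- On `[x, y]` the integrand `1 / p` is smallest at `y`. This turns a loss of energy proportional
to `p` into a fixed gain of `ψ`. -/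
theorem div_pFun_le_psi_sub_psi {E₀ x y : ℝ} (hE : 0 < E₀) (hx : 0 < x) (hxy : x ≤ y) :
    (y - x) / pFun c G y ≤ psi c G E₀ x - psi c G E₀ y := by
  have hy := hx.trans_le hxy
  rw [psi_sub_psi hc hmono hG0 hcont hE hx hy]
  have h := intervalIntegral.integral_mono_on hxy
    (intervalIntegrable_const (c := 1 / pFun c G y) (μ := volume))
    (intervalIntegrable_inv_pFun hc hmono hG0 hcont hx hy) (fun s hs =>
      one_div_le_one_div_of_le (pFun_pos hc hmono hG0 hcont (hx.trans_le hs.1))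
        (pFun_mono hc hmono hG0 hcont (hx.trans_le hs.1).le hs.2))
  rw [intervalIntegral.integral_const, smul_eq_mul, mul_one_div] at h
  exact h

theorem strictAntiOn_psi {E₀ : ℝ} (hE : 0 < E₀) : StrictAntiOn (psi c G E₀) (Ioi 0) := by
  intro x hx y hy hxy
  have h := div_pFun_le_psi_sub_psi hc hmono hG0 hcont hE hx hxy.le
  have := div_pos (sub_pos.2 hxy) (pFun_pos hc hmono hG0 hcont hy)
  linarith

/-- From `p(s) ≤ s / c`, the integrand is at least `c / s`; so `ψ` is unbounded near `0`. -/
theorem mul_log_le_psi {E₀ x : ℝ} (hx : 0 < x) (hxE : x ≤ E₀) :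
    c * Real.log (E₀ / x) ≤ psi c G E₀ x := by
  have hE := hx.trans_le hxE
  have hno : (0 : ℝ) ∉ uIcc x E₀ := fun h => absurd h.1 (not_le.2 (lt_min hx hE))
  rw [← integral_inv_of_pos hx hE, ← intervalIntegral.integral_const_mul]
  refine intervalIntegral.integral_mono_on hxE
    ((intervalIntegral.intervalIntegrable_inv (fun s hs h => hno (h ▸ hs)) continuousOn_id).const_mul c)
    (intervalIntegrable_inv_pFun hc hmono hG0 hcont hx hE) fun s hs => ?_
  have hs0 := hx.trans_le hs.1
  have := one_div_le_one_div_of_le (pFun_pos hc hmono hG0 hcont hs0)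
    (pFun_le_div hc hmono hG0 hcont hs0.le)
  rwa [one_div_div, div_eq_mul_inv] at this

theorem surjOn_psi {E₀ : ℝ} (hE : 0 < E₀) : SurjOn (psi c G E₀) (Ioi 0) (Ici 0) := by
  intro z hz
  have hz : 0 ≤ z := hz
  -- Chosen so that `c * log (E₀ / x) = z`, which puts `z` between `ψ(E₀) = 0` and `ψ(x)`.
  set x := E₀ * Real.exp (-(z / c)) with hxdef
  have hx : 0 < x := by positivity
  have hxE : x ≤ E₀ :=
    mul_le_of_le_one_right hE.le (Real.exp_le_one_iff.2 (neg_nonpos.2 (by positivity)))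
  have hlog : c * Real.log (E₀ / x) = z := by
    have : E₀ / x = Real.exp (z / c) := by
      rw [hxdef, Real.exp_neg]; field_simp
    rw [this, Real.log_exp]; field_simp
  have hbig : z ≤ psi c G E₀ x := hlog ▸ mul_log_le_psi hc hmono hG0 hcont hx hxE
  have hcontψ : ContinuousOn (psi c G E₀) (Icc x E₀) := by
    have h := intervalIntegral.continuousOn_primitive_interval'
      (intervalIntegrable_inv_pFun hc hmono hG0 hcont hx hE) right_mem_uIcc
    rw [uIcc_of_le hxE] at h
    refine h.neg.congr fun s _ => ?_
    simp only [psi, Pi.neg_apply]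
    exact intervalIntegral.integral_symm _ _
  have hE0 : psi c G E₀ E₀ = 0 := by simp [psi]
  obtain ⟨y, hy, hyz⟩ := intermediate_value_Icc' hxE hcontψ ⟨hE0.le.trans hz, hbig⟩
  exact ⟨y, hx.trans_le hy.1, hyz⟩

/-- `E ≤ ψ⁻¹(z)` as soon as `z ≤ ψ(E)`. -/
theorem le_psiInv {E₀ E z : ℝ} (hE : 0 < E₀) (hz : 0 ≤ z) (h : 0 < E → z ≤ psi c G E₀ E) :
    E ≤ psiInv c G E₀ z := by
  have hs := surjOn_psi hc hmono hG0 hcont hE hz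
  have hpos : 0 < psiInv c G E₀ z := Function.invFunOn_mem hs
  have heq : psi c G E₀ (psiInv c G E₀ z) = z := Function.invFunOn_eq hs
  by_contra! hlt
  have h1 := strictAntiOn_psi hc hmono hG0 hcont hE hpos (hpos.trans hlt) hlt
  linarith [h (hpos.trans hlt)]

/-- A nonincreasing function that loses `κ p(E)` over each period `T` decays like
`ψ⁻¹(κ (t - T) / T)`. -/
theorem le_psiInv_of_periodic_loss {E : ℝ → ℝ} {T κ : ℝ} (hT : 0 < T) (hκ : 0 ≤ κ)
    (hE0 : 0 < E 0) (hE : AntitoneOn E (Ici 0))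
    (hloss : ∀ a ≥ 0, κ * pFun c G (E a) ≤ E a - E (a + T)) {t : ℝ} (ht : T ≤ t) :
    E t ≤ psiInv c G (E 0) (κ / T * (t - T)) := by
  -- Positivity is a premise because the energy may vanish in finite time, where `ψ` has no meaning.
  have key : ∀ n : ℕ, 0 < E (n * T) → n * κ ≤ psi c G (E 0) (E (n * T)) := by
    intro n
    induction n with
    | zero => intro; simp [psi]
    | succ n ih =>
      intro hpos
      have hn : (0 : ℝ) ≤ n * T := by positivity
      have hstep : ((n + 1 : ℕ) : ℝ) * T = n * T + T := by push_cast; ring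
      rw [hstep] at hpos ⊢
      have hle : E (n * T + T) ≤ E (n * T) :=
        hE hn (by simp only [mem_Ici]; linarith) (by linarith)
      have h0 : 0 < E (n * T) := hpos.trans_le hle
      have h1 := div_pFun_le_psi_sub_psi hc hmono hG0 hcont hE0 hpos hle
      have h2 : κ ≤ (E (n * T) - E (n * T + T)) / pFun c G (E (n * T)) := by
        rw [le_div_iff₀ (pFun_pos hc hmono hG0 hcont h0)]
        exact hloss _ hn
      push_cast
      linarith [ih h0]
  refine le_psiInv hc hmono hG0 hcont hE0 (mul_nonneg (by positivity) (by linarith)) fun hpos => ?_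
  have ht0 : 0 ≤ t := hT.le.trans ht
  -- Only full periods count; `n > t / T - 1` is the source of the delay `t - T`.
  set n := ⌊t / T⌋₊ with hn
  have hn1 : (n : ℝ) * T ≤ t := (le_div_iff₀ hT).1 (Nat.floor_le (by positivity))
  have hn2 : t / T < n + 1 := Nat.lt_floor_add_one _
  have hle : E t ≤ E (n * T) := hE (by simp only [mem_Ici]; positivity) ht0 hn1
  have h1 := key n (hpos.trans_le hle)
  have h2 := (strictAntiOn_psi hc hmono hG0 hcont hE0).antitoneOn (mem_Ioi.2 hpos)
    (mem_Ioi.2 (hpos.trans_le hle)) hle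
  have h3 : κ / T * (t - T) = κ * (t / T - 1) := by field_simp
  have h4 : κ * (t / T - 1) ≤ κ * n := mul_le_mul_of_nonneg_left (by linarith) hκ
  linarith

end Scalar

/-! ### Energy estimates for the damped system. -/

theorem integrable_inner_of_memLp {Y E : Type*} [MeasurableSpace Y] {ν : Measure Y}
    [NormedAddCommGroup E] [InnerProductSpace ℝ E] {f g : Y → E} (hf : MemLp f 2 ν)
    (hg : MemLp g 2 ν) : Integrable (fun x => ⟪f x, g x⟫_ℝ) ν := by
  refine (L2.integrable_inner (𝕜 := ℝ) (hf.toLp f) (hg.toLp g)).congr ?_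
  filter_upwards [hf.coeFn_toLp, hg.coeFn_toLp] with x h1 h2
  rw [h1, h2]

theorem hasDerivWithinAt_energy {H : Type*} [NormedAddCommGroup H] [InnerProductSpace ℝ H]
    {x : ℝ → H} {f : H} {t : ℝ} {s : Set ℝ}
    (hx : HasDerivWithinAt x f s t) : HasDerivWithinAt (energy x) ⟪x t, f⟫_ℝ s t := by
  have := hx.norm_sq.div_const 2
  rwa [mul_div_cancel_left₀ _ (two_ne_zero)] at this

theorem continuousOn_energy {H : Type*} [NormedAddCommGroup H] {x : ℝ → H} {s : Set ℝ}
    (hx : ContinuousOn x s) :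
    ContinuousOn (energy x) s := (hx.norm.pow 2).div_const 2

namespace DampedSystem

variable {J : ℕ} {N : Fin J → ℕ}
  {V H : Type*} [NormedAddCommGroup V] [InnerProductSpace ℝ V] [CompleteSpace V]
  [NormedAddCommGroup H] [InnerProductSpace ℝ H] [CompleteSpace H]
  {X : Fin J → Type*} [∀ j, MetricSpace (X j)] [∀ j, MeasurableSpace (X j)]
  [∀ j, OpensMeasurableSpace (X j)] (P : DampedSystem N V H X)

theorem memLp_comp (u : V) (j : Fin J) : MemLp (P.comp u j) 2 (P.μ j) := Lp.memLp _

theorem inner_IU (v w : V) :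
    ⟪P.IU v, P.IU w⟫_ℝ = ∑ j, ∫ x, ⟪P.comp v j x, P.comp w j x⟫_ℝ ∂(P.μ j) := by
  rw [PiLp.inner_apply]
  refine Finset.sum_congr rfl fun j _ => ?_
  rw [Submodule.coe_inner, L2.inner_def]
  rfl

theorem continuous_α {t : ℝ} (ht : 0 ≤ t) (j : Fin J) : Continuous (P.α j t) :=
  (P.α_continuous j).comp_continuous (f := fun x => (t, x)) (by fun_prop)
    (fun _ => ⟨ht, mem_univ _⟩)

theorem inner_g_nonneg (j : Fin J) (y : EuclideanSpace ℝ (Fin (N j))) : 0 ≤ ⟪P.g j y, y⟫_ℝ := by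
  simpa [P.g_zero] using P.g_monotone j y 0

theorem damping_self_nonneg {t : ℝ} (ht : 0 ≤ t) (u : V) : 0 ≤ P.damping t u u :=
  Finset.sum_nonneg fun j _ => integral_nonneg fun x =>
    mul_nonneg (P.α_pos j t x ht).le (P.inner_g_nonneg j _)

variable {P} {M α₀ α' : ℝ}

theorem integrable_damping (hM : ∀ j y, ‖P.g j y‖ ≤ M * (1 + ‖y‖))
    (hα : ∀ j t x, 0 ≤ t → P.α j t x ≤ α') {t : ℝ} (ht : 0 ≤ t) (u v : V) (j : Fin J) :
    Integrable (fun x => P.α j t x * ⟪P.g j (P.comp u j x), P.comp v j x⟫_ℝ) (P.μ j) := by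
  have := P.μ_finite j
  have hg : MemLp (fun x => P.g j (P.comp u j x)) 2 (P.μ j) := by
    refine (((memLp_const (1 : ℝ)).add (P.memLp_comp u j).norm)).of_le_mul (c := M)
      ((P.g_continuous j).comp_aestronglyMeasurable (P.memLp_comp u j).1) (ae_of_all _ fun x => ?_)
    have h1 : ‖((fun _ => (1 : ℝ)) + fun x => ‖P.comp u j x‖ : X j → ℝ) x‖ = 1 + ‖P.comp u j x‖ := by
      rw [Pi.add_apply, Real.norm_of_nonneg (by positivity)]
    rw [h1]
    exact hM j _
  refine (integrable_inner_of_memLp hg (P.memLp_comp v j)).bdd_mul (c := α')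
    (P.continuous_α ht j).measurable.aestronglyMeasurable (ae_of_all _ fun x => ?_)
  rw [Real.norm_of_nonneg (P.α_pos j t x ht).le]
  exact hα j t x ht

/-- The growth conditions, linearized at a supergradient. -/
theorem sq_add_sq_le (hM0 : 0 < M) {m : ℝ} (hm : 0 < m)
    (hM : ∀ j y, ‖P.g j y‖ ≤ M * (1 + ‖y‖))
    (hg : ∀ j y, 1 ≤ ‖y‖ → m * ‖y‖ ^ 2 ≤ ⟪P.g j y, y⟫_ℝ) {G : ℝ → ℝ} {β σ : ℝ} (hβ : 0 ≤ β)
    (hσ : 0 ≤ σ) (hG : ∀ s ≥ 0, G s ≤ β + σ * s)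
    (hgG : ∀ j y, ‖y‖ ≤ 1 → ‖y‖ ^ 2 + ‖P.g j y‖ ^ 2 ≤ G ⟪P.g j y, y⟫_ℝ) (j : Fin J)
    (y : EuclideanSpace ℝ (Fin (N j))) :
    ‖y‖ ^ 2 + ‖P.g j y‖ ^ 2 ≤ β + (σ + (1 + 4 * M ^ 2) / m) * ⟪P.g j y, y⟫_ℝ := by
  have h0 := P.inner_g_nonneg j y
  have hσ0 := mul_nonneg hσ h0
  have hK : 0 ≤ (1 + 4 * M ^ 2) / m * ⟪P.g j y, y⟫_ℝ := by positivity
  rcases le_total ‖y‖ 1 with h | h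
  · linarith [hgG j y h, hG _ h0]
  · have h1 := hg j y h
    -- Here `1 ≤ ‖y‖`, so `1 + ‖y‖ ≤ 2 * ‖y‖`.
    have h2 : ‖P.g j y‖ ≤ 2 * M * ‖y‖ := (hM j y).trans (by nlinarith)
    have h3 : ‖P.g j y‖ ^ 2 ≤ (2 * M * ‖y‖) ^ 2 := pow_le_pow_left₀ (norm_nonneg _) h2 2
    have h4 : (1 + 4 * M ^ 2) * ‖y‖ ^ 2 ≤ (1 + 4 * M ^ 2) / m * ⟪P.g j y, y⟫_ℝ := by
      rw [div_mul_eq_mul_div, le_div_iff₀ hm, mul_assoc, mul_comm _ m]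
      exact mul_le_mul_of_nonneg_left h1 (by positivity)
    nlinarith

/-- The dissipation controls the source in the equation for the difference of a solution of the
damped system and a solution of the linear system. -/
theorem source_le (hα₀ : 0 < α₀) (hM : ∀ j y, ‖P.g j y‖ ≤ M * (1 + ‖y‖))
    (hα : ∀ j t x, 0 ≤ t → α₀ ≤ P.α j t x ∧ P.α j t x ≤ α') {β γ μmax : ℝ} (hβ : 0 ≤ β)
    (hγ : 0 ≤ γ) (hpt : ∀ j y, ‖y‖ ^ 2 + ‖P.g j y‖ ^ 2 ≤ β + γ * ⟪P.g j y, y⟫_ℝ)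
    (hμ : ∀ j, (P.μ j).real univ ≤ μmax) {t : ℝ} (ht : 0 ≤ t) (v w : V) :
    -P.damping t v w + ⟪P.IU v, P.IU w⟫_ℝ - ⟪P.IU w, P.IU w⟫_ℝ ≤
      (1 + α' ^ 2) / 2 * (J * μmax * β + γ / α₀ * P.damping t v v) := by
  have hint := integrable_damping hM (fun j t x ht => (hα j t x ht).2) ht
  have hpoint : ∀ j x, -(P.α j t x * ⟪P.g j (P.comp v j x), P.comp w j x⟫_ℝ) +
      ⟪P.comp v j x, P.comp w j x⟫_ℝ - ⟪P.comp w j x, P.comp w j x⟫_ℝ ≤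
      (1 + α' ^ 2) / 2 * (β + γ / α₀ * (P.α j t x * ⟪P.g j (P.comp v j x), P.comp v j x⟫_ℝ)) := by
    intro j x
    set u := P.comp v j x
    set z := P.comp w j x
    obtain ⟨ha0, ha1⟩ := hα j t x ht
    set a := P.α j t x
    have hgu := P.inner_g_nonneg j u
    -- Young's inequality spends half of `‖z‖ ^ 2` here and half in `h2`; together they cancel
    -- against `-⟪z, z⟫`.
    have h1 : -(a * ⟪P.g j u, z⟫_ℝ) ≤ α' ^ 2 / 2 * ‖P.g j u‖ ^ 2 + ‖z‖ ^ 2 / 2 := by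
      have h := (abs_le.1 (abs_real_inner_le_norm (P.g j u) z)).1
      have h' : -(a * ⟪P.g j u, z⟫_ℝ) ≤ a * (‖P.g j u‖ * ‖z‖) := by nlinarith
      have h'' : a * (‖P.g j u‖ * ‖z‖) ≤ α' * (‖P.g j u‖ * ‖z‖) :=
        mul_le_mul_of_nonneg_right ha1 (by positivity)
      nlinarith [sq_nonneg (α' * ‖P.g j u‖ - ‖z‖)]
    have h2 : ⟪u, z⟫_ℝ ≤ ‖u‖ ^ 2 / 2 + ‖z‖ ^ 2 / 2 := by
      nlinarith [real_inner_le_norm u z, sq_nonneg (‖u‖ - ‖z‖)]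
    have h3 : γ * ⟪P.g j u, u⟫_ℝ ≤ γ / α₀ * (a * ⟪P.g j u, u⟫_ℝ) := by
      have : γ * ⟪P.g j u, u⟫_ℝ = γ / α₀ * (α₀ * ⟪P.g j u, u⟫_ℝ) := by field_simp
      rw [this]
      gcongr
    have h4 := hpt j u
    have h5 : (1 + α' ^ 2) / 2 * (‖u‖ ^ 2 + ‖P.g j u‖ ^ 2) ≤
        (1 + α' ^ 2) / 2 * (β + γ / α₀ * (a * ⟪P.g j u, u⟫_ℝ)) :=
      mul_le_mul_of_nonneg_left (by linarith) (by positivity)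
    rw [real_inner_self_eq_norm_sq]
    nlinarith [sq_nonneg (α' * ‖u‖), sq_nonneg ‖P.g j u‖]
  have hj : ∀ j, -(∫ x, P.α j t x * ⟪P.g j (P.comp v j x), P.comp w j x⟫_ℝ ∂(P.μ j)) +
      (∫ x, ⟪P.comp v j x, P.comp w j x⟫_ℝ ∂(P.μ j)) -
      (∫ x, ⟪P.comp w j x, P.comp w j x⟫_ℝ ∂(P.μ j)) ≤
      (1 + α' ^ 2) / 2 * (μmax * β + γ / α₀ *
        ∫ x, P.α j t x * ⟪P.g j (P.comp v j x), P.comp v j x⟫_ℝ ∂(P.μ j)) := by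
    intro j
    have := P.μ_finite j
    have i1 := hint v w j
    have i2 := integrable_inner_of_memLp (P.memLp_comp v j) (P.memLp_comp w j)
    have i3 := integrable_inner_of_memLp (P.memLp_comp w j) (P.memLp_comp w j)
    have i4 := (hint v v j).const_mul (γ / α₀)
    have h := integral_mono ((i1.neg.add i2).sub i3)
      (((integrable_const β).add i4).const_mul ((1 + α' ^ 2) / 2)) (hpoint j)
    rw [integral_const_mul] at h
    simp only [Pi.add_apply, Pi.neg_apply, Pi.sub_apply] at h
    rw [integral_add (integrable_const β) i4, integral_const, integral_const_mul, smul_eq_mul] at h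
    have e1 := integral_sub (i1.neg.add i2) i3
    have e2 := integral_add i1.neg i2
    simp only [Pi.add_apply, Pi.neg_apply] at e1 e2
    rw [e1, e2, integral_neg] at h
    refine h.trans ?_
    have := mul_le_mul_of_nonneg_right (hμ j) hβ
    gcongr
  rw [inner_IU, inner_IU]
  simp only [damping]
  rw [← Finset.sum_neg_distrib, ← Finset.sum_add_distrib, ← Finset.sum_sub_distrib]
  refine (Finset.sum_le_sum fun j _ => hj j).trans (le_of_eq ?_)
  rw [← Finset.mul_sum, Finset.sum_add_distrib, ← Finset.mul_sum _ _ (γ / α₀)]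
  simp only [Finset.sum_const, Finset.card_univ, Fintype.card_fin, nsmul_eq_mul]
  ring

theorem IsSolution.exists_vector {x : ℝ → H} (hx : P.IsSolution x) :
    ∃ v : ℝ → V, ∃ f : ℝ → H, ∃ Z : Set ℝ, Z.Countable ∧ (∀ t, 0 ≤ t → P.ι (v t) = x t) ∧
      (∀ t, 0 ≤ t → ∀ w, P.A₁ (v t) w + P.damping t (v t) w = ⟪f t, P.ι w⟫_ℝ) ∧
      ∀ t, 0 ≤ t → t ∉ Z → HasDerivWithinAt x (-f t) (Ioi t) t := by
  obtain ⟨-, f, hf, Z, hZ, hd⟩ := hx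
  choose v hv using hf
  refine ⟨fun t => if h : 0 ≤ t then v t h else 0, f, Z, hZ, fun t ht => ?_, fun t ht => ?_,
    fun t ht htZ => ?_⟩
  · simp only [dif_pos ht, (hv t ht).1]
  · simpa only [dif_pos ht] using (hv t ht).2
  · exact (hd t ⟨ht, htZ⟩).1.mono fun s hs => ht.trans (le_of_lt hs)

/-- Testing the equation with the solution itself kills `A₁` by skewness and leaves minus the
damping, which has a sign since `g` is monotone and vanishes at `0`. -/
theorem IsSolution.antitoneOn_energy {x : ℝ → H} (hx : P.IsSolution x) :
    AntitoneOn (energy x) (Ici 0) := by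
  obtain ⟨v, f, Z, hZ, hv, hf, hd⟩ := hx.exists_vector
  intro a ha b _ hab
  have ha : 0 ≤ a := ha
  refine le_of_hasDerivWithinAt_nonpos_off_countable hab
    (continuousOn_energy (hx.1.mono fun t ht => ha.trans ht.1)) hZ
    (fun t ht => hasDerivWithinAt_energy (hd t (ha.trans ht.1.1) ht.2)) fun t ht => ?_
  have ht0 := ha.trans ht.1.1
  have h := hf t ht0 (v t)
  rw [P.A₁_skew, hv t ht0, zero_add] at h
  rw [inner_neg_right, real_inner_comm, ← h]
  linarith [P.damping_self_nonneg ht0 (v t)]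

/-- Comparison of a solution with an orbit of the linear semigroup. -/
theorem IsSolution.energy_sub_orbit_le {x : ℝ → H} (hx : P.IsSolution x) {S : ℝ → H →L[ℝ] H}
    (hS : IsContractionSemigroup S) (hgen : IsGenerator P.graphForward S) {A B : ℝ}
    (hsrc : ∀ t, 0 ≤ t → ∀ v w, -P.damping t v w + ⟪P.IU v, P.IU w⟫_ℝ - ⟪P.IU w, P.IU w⟫_ℝ ≤
      A + B * P.damping t v v) {a T : ℝ} (ha : 0 ≤ a) (hT : 0 ≤ T) {y fy : H}
    (hy : Tendsto (fun t : ℝ => t⁻¹ • (S t y - y)) (𝓝[>] 0) (𝓝 fy)) :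
    ‖x (a + T) - S T y‖ ^ 2 / 2 ≤
      ‖x a - y‖ ^ 2 / 2 + B * (energy x a - energy x (a + T)) + A * T := by
  obtain ⟨v, f, Z, hZ, hv, hf, hd⟩ := hx.exists_vector
  set d : ℝ → H := fun t => x t - S (t - a) y with hddef
  have hxc : ContinuousOn x (Icc a (a + T)) := hx.1.mono fun t ht => ha.trans ht.1
  have hdc : ContinuousOn d (Icc a (a + T)) :=
    hxc.sub ((hS.continuous y).comp (f := fun t => t - a) (by fun_prop)
      fun t ht => sub_nonneg.2 ht.1)
  -- The damping is minus the derivative of `energy x`, so adding `B * energy x t - A * t`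
  -- compensates the source and no integral of the damping is needed.
  have key := le_of_hasDerivWithinAt_nonpos_off_countable
    (ρ := fun t => energy d t + B * energy x t - A * t)
    (ρ' := fun t => ⟪d t, -f t - S (t - a) fy⟫_ℝ + B * ⟪x t, -f t⟫_ℝ - A * 1)
    (le_add_of_nonneg_right hT : a ≤ a + T)
    (((continuousOn_energy hdc).add (continuousOn_const.mul (continuousOn_energy hxc))).sub
      (by fun_prop)) hZ (fun t ht => ?_) (fun t ht => ?_)
  · simp only [energy, hddef, add_sub_cancel_left, sub_self, hS.zero,
      ContinuousLinearMap.id_apply] at key ⊢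
    linarith
  · have ht0 := ha.trans ht.1.1
    have hx' := hd t ht0 ht.2
    have hy' := hS.hasDerivWithinAt_orbit ht.1.1
      (hS.tendsto_generator_orbit hy (sub_nonneg.2 ht.1.1))
    exact ((hasDerivWithinAt_energy (hx'.sub hy')).add
      ((hasDerivWithinAt_energy hx').const_mul B)).sub ((hasDerivWithinAt_id t _).const_mul A)
  · have ht0 := ha.trans ht.1.1
    -- The orbit stays in the domain of the generator, hence in `V`; this makes the difference an
    -- admissible test vector.
    obtain ⟨vy, hvy, hvy'⟩ :=
      (hgen _ _).2 (hS.tendsto_generator_orbit hy (sub_nonneg.2 ht.1.1))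
    have e1 : d t = P.ι (v t - vy) := by rw [map_sub, hv t ht0, hvy]
    have h1 := hf t ht0 (v t - vy)
    have h2 := hvy' (v t - vy)
    have h3 := hf t ht0 (v t)
    rw [P.A₁_skew, hv t ht0, zero_add] at h3
    have h4 := hsrc t ht0 (v t) (v t - vy)
    have h5 : P.A₁ (v t) (v t - vy) - P.A₁ vy (v t - vy) = 0 := by
      rw [← sub_apply, ← map_sub, P.A₁_skew]
    have h6 : ⟪P.IU (v t - vy), P.IU (v t - vy)⟫_ℝ =
        ⟪P.IU (v t), P.IU (v t - vy)⟫_ℝ - ⟪P.IU vy, P.IU (v t - vy)⟫_ℝ := by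
      rw [← inner_sub_left, ← P.IU.map_sub]
    rw [e1, real_inner_comm, inner_sub_left, inner_neg_left, ← h1, ← h2, inner_neg_right,
      real_inner_comm (f t) (x t), ← h3]
    linarith

/-- The same with the orbit of `x a` itself, by density of the domain. -/
theorem IsSolution.energy_add_le {x : ℝ → H} (hx : P.IsSolution x) {S : ℝ → H →L[ℝ] H}
    (hS : IsContractionSemigroup S) (hgen : IsGenerator P.graphForward S) {A B : ℝ}
    (hsrc : ∀ t, 0 ≤ t → ∀ v w, -P.damping t v w + ⟪P.IU v, P.IU w⟫_ℝ - ⟪P.IU w, P.IU w⟫_ℝ ≤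
      A + B * P.damping t v v) {a T : ℝ} (ha : 0 ≤ a) (hT : 0 ≤ T) :
    energy x (a + T) ≤
      ‖S T (x a)‖ ^ 2 + 2 * B * (energy x a - energy x (a + T)) + 2 * A * T := by
  choose y fy hy hyf using fun n : ℕ =>
    hS.exists_generator_near (x a) (Nat.one_div_pos_of_nat (α := ℝ) (n := n))
  have hlim : Tendsto y atTop (𝓝 (x a)) := by
    rw [tendsto_iff_norm_sub_tendsto_zero]
    exact squeeze_zero (fun _ => norm_nonneg _) (fun n => (hy n).le)
      tendsto_one_div_add_atTop_nhds_zero_nat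
  have hle : ‖x (a + T) - S T (x a)‖ ^ 2 / 2 ≤
      ‖x a - x a‖ ^ 2 / 2 + B * (energy x a - energy x (a + T)) + A * T :=
    le_of_tendsto_of_tendsto'
      (((tendsto_const_nhds.sub (((S T).continuous.tendsto _).comp hlim)).norm.pow 2).div_const 2)
      ((((((tendsto_const_nhds.sub hlim).norm.pow 2).div_const 2).add_const _).add_const _))
      fun n => hx.energy_sub_orbit_le hS hgen hsrc ha hT (hyf n)
  have htri := norm_add_le (x (a + T) - S T (x a)) (S T (x a))
  rw [sub_add_cancel] at htri
  have hsq := pow_le_pow_left₀ (norm_nonneg _) htri 2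
  rw [sub_self, norm_zero] at hle
  simp only [energy] at hle ⊢
  -- `(p + q)² ≤ 2 p² + 2 q²`, which accounts for the factors `2`.
  nlinarith [sq_nonneg (‖x (a + T) - S T (x a)‖ - ‖S T (x a)‖)]

end DampedSystem

/-! ### Energy against energy loss over one period. -/

/-- The constant `c` of the decay estimate. -/
noncomputable def decayConst (J : ℕ) (T μmax α₀ α' M m : ℝ) : ℝ :=
  -- The absolute value and the `1` give positivity for every real `μmax`, zero and negative values
  -- included.
  1 + |μmax| * (2 * T ^ 2 * α₀ +
    2 * (1 + α' ^ 2) * (T ^ 2 + T * J + (1 + 4 * M ^ 2) / m * T ^ 2))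

theorem decayConst_pos {J : ℕ} {T μmax α₀ α' M m : ℝ} (hT : 0 < T) (hα₀ : 0 < α₀) (hm : 0 < m) :
    0 < decayConst J T μmax α₀ α' M m := by
  unfold decayConst; positivity

/-- Over one period the energy is controlled by its loss. -/
theorem DampedSystem.IsSolution.energy_le_hFun {J : ℕ} {N : Fin J → ℕ}
    {V H : Type*} [NormedAddCommGroup V] [InnerProductSpace ℝ V] [CompleteSpace V]
    [NormedAddCommGroup H] [InnerProductSpace ℝ H] [CompleteSpace H]
    {X : Fin J → Type*} [∀ j, MetricSpace (X j)] [∀ j, MeasurableSpace (X j)]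
    [∀ j, OpensMeasurableSpace (X j)] {P : DampedSystem N V H X} {x : ℝ → H}
    (hx : P.IsSolution x) {S : ℝ → H →L[ℝ] H} (hS : IsContractionSemigroup S)
    (hgen : IsGenerator P.graphForward S) {T μmax α₀ α' M m : ℝ} (hT : 0 < T)
    (hST : ∀ u, ‖S T u‖ ≤ 1 / 2 * ‖u‖) (hα₀ : 0 < α₀) (hM0 : 0 < M) (hm : 0 < m)
    (hμ0 : 0 ≤ μmax) (hμ : ∀ j, (P.μ j).real univ ≤ μmax)
    (hM : ∀ j y, ‖P.g j y‖ ≤ M * (1 + ‖y‖))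
    (hg : ∀ j y, 1 ≤ ‖y‖ → m * ‖y‖ ^ 2 ≤ ⟪P.g j y, y⟫_ℝ) {G : ℝ → ℝ}
    (hG : ConcaveOn ℝ (Ici 0) G) (hmono : StrictMonoOn G (Ici 0)) (hG0 : G 0 = 0)
    (hgG : ∀ j y, ‖y‖ ≤ 1 → ‖y‖ ^ 2 + ‖P.g j y‖ ^ 2 ≤ G ⟪P.g j y, y⟫_ℝ)
    (hα : ∀ j t x, 0 ≤ t → α₀ ≤ P.α j t x ∧ P.α j t x ≤ α') {a s : ℝ} (ha : 0 ≤ a) (hs : 0 < s)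
    (hloss : energy x a - energy x (a + T) ≤ T ^ 2 * μmax * α₀ * s) :
    energy x a ≤ hFun (decayConst J T μmax α₀ α' M m) G s := by
  obtain ⟨σ, hσ, hsup⟩ := exists_supergradient hG hmono.monotoneOn hs
  -- The supporting line is nonnegative at `0`. Hence `σ * s ≤ G s`, which removes `σ` from the
  -- final bound.
  have hβ : 0 ≤ G s - σ * s := by have := hsup 0 le_rfl; rw [hG0] at this; linarith
  have hGs : 0 ≤ G s := by have := mul_nonneg hσ hs.le; linarith
  set K := (1 + 4 * M ^ 2) / m with hK
  have hK0 : 0 ≤ K := by positivity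
  set L := (1 + α' ^ 2) / 2 with hL
  have hL0 : 0 ≤ L := by positivity
  have hpt := P.sq_add_sq_le hM0 hm hM hg hβ hσ (fun t ht => by linarith [hsup t ht]) hgG
  have hest := hx.energy_add_le hS hgen (A := L * (J * μmax * (G s - σ * s)))
    (B := L * ((σ + K) / α₀)) (fun t ht v w => by
      refine (source_le hα₀ hM hα hβ (add_nonneg hσ hK0) hpt hμ ht v w).trans (le_of_eq ?_)
      ring) ha hT.le
  set D := energy x a - energy x (a + T) with hD
  have h1 : ‖S T (x a)‖ ^ 2 ≤ energy x a / 2 := by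
    have := pow_le_pow_left₀ (norm_nonneg _) (hST (x a)) 2
    simp only [energy]; linarith
  have h2 : L * ((σ + K) / α₀) * D ≤ L * μmax * T ^ 2 * (G s + K * s) := by
    have e : L * ((σ + K) / α₀) * (T ^ 2 * μmax * α₀ * s) =
        L * μmax * T ^ 2 * (σ * s + K * s) := by field_simp
    calc L * ((σ + K) / α₀) * D ≤ L * ((σ + K) / α₀) * (T ^ 2 * μmax * α₀ * s) :=
          mul_le_mul_of_nonneg_left hloss (by positivity)
      _ = L * μmax * T ^ 2 * (σ * s + K * s) := e
      _ ≤ L * μmax * T ^ 2 * (G s + K * s) := by gcongr; linarith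
  have h3 : L * (J * μmax * (G s - σ * s)) * T ≤ L * (J * μmax * G s) * T := by
    gcongr
    linarith [mul_nonneg hσ hs.le]
  -- Absorbing `energy x a / 2` leaves `energy x a ≤ 2 D + 4 B D + 4 A T`, with `A`, `B` as in
  -- `hest`. The first three summands bound these; the last is the nonnegative surplus from using
  -- one constant for both `s` and `G s`.
  have h4 : hFun (decayConst J T μmax α₀ α' M m) G s =
      2 * (T ^ 2 * μmax * α₀ * s) + 4 * (L * μmax * T ^ 2 * (G s + K * s)) +
      4 * (L * (J * μmax * G s) * T) + (s + G s + 2 * T ^ 2 * μmax * α₀ * G s +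
      4 * L * μmax * (T ^ 2 * s + T * J * s + K * T ^ 2 * G s)) := by
    have : 2 * (1 + α' ^ 2) = 4 * L := by rw [hL]; ring
    rw [hFun, decayConst, ← hK, this, abs_of_nonneg hμ0]
    ring
  have h5 : 0 ≤ s + G s + 2 * T ^ 2 * μmax * α₀ * G s +
      4 * L * μmax * (T ^ 2 * s + T * J * s + K * T ^ 2 * G s) := by positivity
  linarith

end HyperbolicDamping

/-! ### Assembly of the decay estimate. -/

theorem mainTheorem3 (J : ℕ) (hJ : 0 < J) (C ω : ℝ) (hC : 0 < C) (hω : 0 < ω) :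
    ∃ T₀ > 0, ∀ T ≥ T₀, ∀ μmax α₀ α' M m : ℝ, 0 < α₀ → 0 < α' → 0 < M → 0 < m →
      ∃ c > 0, ∀ (N : Fin J → ℕ)
        (V H : Type*) [NormedAddCommGroup V] [InnerProductSpace ℝ V] [CompleteSpace V]
        [NormedAddCommGroup H] [InnerProductSpace ℝ H] [CompleteSpace H]
        (X : Fin J → Type*) [∀ j, MetricSpace (X j)] [∀ j, MeasurableSpace (X j)]
        [∀ j, OpensMeasurableSpace (X j)]
        (P : HyperbolicDamping.DampedSystem N V H X) (G : ℝ → ℝ),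
        ⨆ j, (P.μ j).real univ = μmax →
        P.LinearlyStable C ω →
        (∀ j y, ‖P.g j y‖ ≤ M * (1 + ‖y‖)) →
        (∀ j y, 1 ≤ ‖y‖ → m * ‖y‖ ^ 2 ≤ ⟪P.g j y, y⟫_ℝ) →
        ConcaveOn ℝ (Ici 0) G → StrictMonoOn G (Ici 0) → G 0 = 0 → ContinuousOn G (Ici 0) →
        (∀ j y, ‖y‖ ≤ 1 → ‖y‖ ^ 2 + ‖P.g j y‖ ^ 2 ≤ G ⟪P.g j y, y⟫_ℝ) →
        (∀ j t x, 0 ≤ t → α₀ ≤ P.α j t x ∧ P.α j t x ≤ α') →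
        -- `h` is invertible on `[0, ∞)`, so that `p = h⁻¹` is well defined
        BijOn (HyperbolicDamping.hFun c G) (Ici 0) (Ici 0) ∧
        ∀ x : ℝ → H, P.IsSolution x →
          (0 < HyperbolicDamping.energy x 0 →
            -- `ψ` is well defined on `(0, ∞)` and has an inverse defined on `[0, ∞)`
            (∀ y > 0, IntervalIntegrable (fun s => 1 / HyperbolicDamping.pFun c G s) volume
              y (HyperbolicDamping.energy x 0)) ∧
            StrictAntiOn (HyperbolicDamping.psi c G (HyperbolicDamping.energy x 0)) (Ioi 0) ∧
            SurjOn (HyperbolicDamping.psi c G (HyperbolicDamping.energy x 0)) (Ioi 0) (Ici 0) ∧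
            ∀ t ≥ T, HyperbolicDamping.energy x t ≤
              HyperbolicDamping.psiInv c G (HyperbolicDamping.energy x 0)
                (T * (⨅ j, (P.μ j).real univ) * α₀ * (t - T))) ∧
          (HyperbolicDamping.energy x 0 = 0 → ∀ t ≥ T, HyperbolicDamping.energy x t = 0) := by
  -- The logarithm is the time at which `C * exp (-ω * T)` reaches `1 / 2`; the `1` keeps `T₀`
  -- positive.
  refine ⟨max 1 (Real.log (2 * C) / ω), by positivity, fun T hT μmax α₀ α' M m hα₀ _ hM0 hm => ?_⟩
  have hT0 : 0 < T := one_pos.trans_le ((le_max_left _ _).trans hT)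
  have hexp : C * Real.exp (-ω * T) ≤ 1 / 2 := by
    have h1 : Real.log (2 * C) ≤ ω * T := by
      have := (le_max_right _ _).trans hT
      rwa [div_le_iff₀ hω, mul_comm T] at this
    have h2 : 2 * C ≤ Real.exp (ω * T) := (Real.log_le_iff_le_exp (by positivity)).1 h1
    rw [neg_mul, Real.exp_neg, ← div_eq_mul_inv, div_le_iff₀ (Real.exp_pos _)]
    linarith
  have hc : 0 < HyperbolicDamping.decayConst J T μmax α₀ α' M m :=
    HyperbolicDamping.decayConst_pos hT0 hα₀ hm
  refine ⟨_, hc, ?_⟩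
  intro N V H _ _ _ _ _ _ X _ _ _ P G hμmax hstab hM hg hG hmono hG0 hGc hgG hα
  refine ⟨HyperbolicDamping.bijOn_hFun hc hmono hG0 hGc, fun x hx => ?_⟩
  obtain ⟨-, S, hS, hgen, hdecay⟩ := hstab
  have hST : ∀ u, ‖S T u‖ ≤ 1 / 2 * ‖u‖ := fun u =>
    (hdecay T hT0.le u).trans (mul_le_mul_of_nonneg_right hexp (norm_nonneg u))
  have hμ : ∀ j, (P.μ j).real univ ≤ μmax := fun j =>
    hμmax ▸ le_ciSup (f := fun j => (P.μ j).real univ) (finite_range _).bddAbove j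
  have : Nonempty (Fin J) := ⟨⟨0, hJ⟩⟩
  set μ := ⨅ j, (P.μ j).real univ with hμdef
  have hμ0 : 0 ≤ μ := le_ciInf fun j => measureReal_nonneg
  have hμle : μ ≤ μmax := (ciInf_le (finite_range _).bddBelow ⟨0, hJ⟩).trans (hμ _)
  have hanti := hx.antitoneOn_energy
  refine ⟨fun hE => ⟨fun y hy => HyperbolicDamping.intervalIntegrable_inv_pFun hc hmono hG0 hGc hy hE,
    HyperbolicDamping.strictAntiOn_psi hc hmono hG0 hGc hE,
    HyperbolicDamping.surjOn_psi hc hmono hG0 hGc hE, fun t ht => ?_⟩, fun hE t ht => ?_⟩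
  · have hκ : 0 ≤ T ^ 2 * μ * α₀ := by positivity
    have hrate : T * μ * α₀ = T ^ 2 * μ * α₀ / T := by field_simp
    rw [hrate]
    refine HyperbolicDamping.le_psiInv_of_periodic_loss hc hmono hG0 hGc hT0 hκ hE hanti
      (fun a ha => ?_) ht
    have hD : 0 ≤ HyperbolicDamping.energy x a - HyperbolicDamping.energy x (a + T) :=
      sub_nonneg.2 (hanti ha (add_nonneg ha hT0.le) (le_add_of_nonneg_right hT0.le))
    -- `κ` vanishes when some `X j` has measure zero; the loss is then just monotonicity.
    rcases hκ.eq_or_lt with h0 | hpos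
    · rwa [← h0, zero_mul]
    rw [mul_comm, ← le_div_iff₀ hpos]
    -- The loss may be zero, while a supporting line is available only at positive points; so the
    -- bound is proved for every `s` above the rescaled loss.
    refine le_of_forall_gt_imp_ge_of_dense fun s hs => ?_
    have hs0 : 0 < s := (div_nonneg hD hκ).trans_lt hs
    have hEa : 0 ≤ HyperbolicDamping.energy x a := by
      unfold HyperbolicDamping.energy; positivity
    refine HyperbolicDamping.pFun_le_of_le_hFun hc hmono hG0 hGc hEa hs0.le
      (hx.energy_le_hFun hS hgen hT0 hST hα₀ hM0 hm (hμ0.trans hμle) hμ hM hg hG hmono hG0 hgG hα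
        ha hs0 ?_)
    rw [div_lt_iff₀ hpos, mul_comm] at hs
    exact hs.le.trans (by gcongr)
  · refine le_antisymm ?_ (by unfold HyperbolicDamping.energy; positivity)
    exact hE ▸ hanti self_mem_Ici (hT0.le.trans ht) (hT0.le.trans ht)
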